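/- **Theorem 3.1 (existence).** Let $\varepsilon>0$, $L>0$ and let $k\in L^\infty([0,L])$ be real-valued, bounded away from zero in the sense that $k\ge c$ a.e. on $[0,L]$ for some constant $c>0$, and continuous at the end points $0$ and $L$ (that is, $k$ is given by a representative that is continuous at $0$ and at $L$ relative to $[0,L]$, with values $k(0)$ and $k(L)$ there). Let $0<\alpha<1$ and $0<\beta<1$. Then the one-dimensional area-averaged stationary problem $$\partial_x\big(k\,j\big)=0 \ \text{ on } (0,L),\qquad j=-\varepsilon\,\partial_x\rho+\rho(1-\rho),\qquad j=\alpha(1-\rho)\ \text{ at } x=0,\qquad j=\beta\rho\ \text{ at } x=L,$$ has at least one weak solution $\rho\in H^1(0,L)$, i.e. a function $\rho\in H^1(0,L)$ such that $$\int_0^L k\,\big(\varepsilon\,\partial_x\rho-\rho(1-\rho)\big)\,\partial_x\phi\,\mathrm dx-\alpha\,k(0)\,(1-\rho(0))\,\phi(0)+\beta\,k(L)\,\rho(L)\,\phi(L)=0\qquad\text{for all }\phi\in H^1(0,L),$$ and this $\rho$ satisfies $0<\rho(x)<1$ for all $x\in[0,L]$. Here $\partial_x$ denotes the weak derivative, and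 functions in $H^1(0,L)$ are identified with their representatives that are continuous on $[0,L]$. -/

import Mathlib

open MeasureTheory Set
open scoped ContDiff

/-- `g` is a weak (distributional) derivative of `u` on the open interval `(0, L)`:
`∫₀ᴸ u φ' = -∫₀ᴸ g φ` for all smooth `φ` with compact support in `(0, L)`. -/
def IsWeakDeriv (L : ℝ) (u g : ℝ → ℝ) : Prop :=
  ∀ φ : ℝ → ℝ, ContDiff ℝ ∞ φ → HasCompactSupport φ → tsupport φ ⊆ Ioo 0 L →
    ∫ x in (0 : ℝ)..L, u x * deriv φ x = -∫ x in (0 : ℝ)..L, g x * φ x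

/-- `u ∈ H¹(0, L)` with weak derivative `g`: both are square integrable on `(0, L)` and `g` is
a weak derivative of `u`. As usual in one dimension, an element of `H¹(0, L)` is represented by
its unique representative that is continuous on `[0, L]`, so that the boundary values `u 0` and
`u L` make sense. The values of `u` outside `[0, L]` are irrelevant, and the weak derivative is
determined up to null sets. -/
structure IsH1 (L : ℝ) (u g : ℝ → ℝ) : Prop where
  continuousOn : ContinuousOn u (Icc 0 L)
  memLp : MemLp u 2 (volume.restrict (Ioo 0 L))
  memLp_deriv : MemLp g 2 (volume.restrict (Ioo 0 L))
  weakDeriv : IsWeakDeriv L u g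

/-- `ρ` is a weak solution of the stationary boundary value problem
`∂ₓ(k j) = 0` on `(0, L)`, with `j = -ε ∂ₓρ + ρ (1 - ρ)`,
`j = α (1 - ρ)` at `0` and `j = β ρ` at `L`:
it lies in `H¹(0, L)`, and the equation tested against every `φ ∈ H¹(0, L)` holds.
Here `dρ` and `dφ` are the weak derivatives of `ρ` and `φ`. -/
def IsWeakSolution (ε L α β : ℝ) (k ρ : ℝ → ℝ) : Prop :=
  ∃ dρ : ℝ → ℝ, IsH1 L ρ dρ ∧
    ∀ φ dφ : ℝ → ℝ, IsH1 L φ dφ →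
      (∫ x in (0 : ℝ)..L, k x * (ε * dρ x - ρ x * (1 - ρ x)) * dφ x)
        - α * k 0 * (1 - ρ 0) * φ 0 + β * k L * ρ L * φ L = 0

/-! The equation says that `k j` is a constant `J`, so `ε ρ' = ρ (1 - ρ) - J / k`. As `k` is only
bounded, set `u = ρ + (J / ε) K` with `K` a primitive of `1 / k`: then `u' = ρ (1 - ρ) / ε` has a
continuous right-hand side, and truncating the nonlinearity makes Picard-Lindelöf global.

Shoot from `ρ 0 = s`, which fixes `J = α k(0) (1 - s)`. The mismatch `β k(L) ρ(L) - J` is negative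
at `s = 0` and positive at `s = 1`, so it vanishes for some `s` strictly between. Since `K` is
nondecreasing, comparison shows that `ρ` cannot recover from a value `≤ 0` (but `ρ(L) > 0`) nor
reach `1` from below. So the truncation is inactive.

The weak form then reduces to `∫ φ' = φ(L) - φ(0)`, which for distributional derivatives rests on du
Bois-Reymond's lemma. -/

lemma continuousOn_primitive_Icc {L : ℝ} (hL : 0 ≤ L) {g : ℝ → ℝ}
    (hg : IntervalIntegrable g volume 0 L) :
    ContinuousOn (fun x ↦ ∫ t in (0 : ℝ)..x, g t) (Icc 0 L) := by
  have := intervalIntegral.continuousOn_primitive_interval (a := 0) (b := L) (f := g)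
    (μ := volume) (by rwa [← intervalIntegrable_iff'])
  rwa [uIcc_of_le hL] at this

/-! ### Weak derivatives and primitives on an interval -/

/-- Integration by parts of a primitive against a smooth function. -/
lemma integral_primitive_mul_deriv {L : ℝ} {g φ : ℝ → ℝ}
    (hg : IntervalIntegrable g volume 0 L) (hφ : ContDiff ℝ ∞ φ) (s : ℝ) :
    ∫ x in (0 : ℝ)..L, (s + ∫ t in (0 : ℝ)..x, g t) * deriv φ x =
      (s + ∫ t in (0 : ℝ)..L, g t) * φ L - s * φ 0 - ∫ x in (0 : ℝ)..L, g x * φ x := by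
  have hac : AbsolutelyContinuousOnInterval (fun x ↦ s + ∫ t in (0 : ℝ)..x, g t) 0 L := by
    have h1 : AbsolutelyContinuousOnInterval (fun _ : ℝ ↦ s) 0 L :=
      ((LipschitzWith.const s).lipschitzOnWith).absolutelyContinuousOnInterval
    exact h1.add (hg.absolutelyContinuousOnInterval_intervalIntegral (by simp))
  have hφac : AbsolutelyContinuousOnInterval φ 0 L := by
    obtain ⟨K, hK⟩ := (hφ.of_le (by norm_num)).locallyLipschitz.locallyLipschitzOn
      |>.exists_lipschitzOnWith_of_compact (isCompact_uIcc (a := (0 : ℝ)) (b := L))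
    exact hK.absolutelyContinuousOnInterval
  rw [hac.integral_mul_deriv_eq_deriv_mul hφac]
  simp only [intervalIntegral.integral_same, add_zero]
  congr 1
  apply intervalIntegral.integral_congr_ae
  filter_upwards [hg.ae_hasDerivAt_integral] with x hx hx'
  have := (hx (uIoc_subset_uIcc hx') 0 (by simp)).const_add s
  rw [this.deriv]

/-- A test function on `(0, L)` with zero integral has a primitive that is a test function. -/
lemma exists_testFunction_primitive {L : ℝ} {η : ℝ → ℝ} (hη : ContDiff ℝ ∞ η)
    (hc : HasCompactSupport η) (hs : tsupport η ⊆ Ioo 0 L)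
    (h0 : ∫ x in (0 : ℝ)..L, η x = 0) :
    ∃ ψ : ℝ → ℝ, ContDiff ℝ ∞ ψ ∧ HasCompactSupport ψ ∧ tsupport ψ ⊆ Ioo 0 L ∧ deriv ψ = η := by
  rcases (tsupport η).eq_empty_or_nonempty with he | hne
  · rw [tsupport_eq_empty_iff] at he
    subst he
    refine ⟨0, contDiff_const, HasCompactSupport.zero, by simp, by ext; simp⟩
  obtain ⟨a, haS, ha⟩ := IsCompact.exists_isLeast hc hne
  obtain ⟨b, hbS, hb⟩ := IsCompact.exists_isGreatest hc hne
  have ha0 := hs haS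
  have hb0 := hs hbS
  have hz : ∀ x, x ∉ Icc a b → η x = 0 := fun x hx ↦
    image_eq_zero_of_notMem_tsupport fun hm ↦ hx ⟨ha hm, hb hm⟩
  have hi : ∀ x y, IntervalIntegrable η volume x y := fun x y ↦
    hη.continuous.intervalIntegrable x y
  have hd : ∀ x, HasDerivAt (fun x ↦ ∫ t in (0 : ℝ)..x, η t) (η x) x := fun x ↦
    intervalIntegral.integral_hasDerivAt_right (hi _ _)
      (hη.continuous.stronglyMeasurableAtFilter _ _) hη.continuous.continuousAt
  have hder : deriv (fun x ↦ ∫ t in (0 : ℝ)..x, η t) = η := funext fun x ↦ (hd x).deriv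
  -- Left of `a` the integrand vanishes; right of `b` the primitive equals the total integral, which
  -- is zero.
  have hsupp : Function.support (fun x ↦ ∫ t in (0 : ℝ)..x, η t) ⊆ Icc a b := by
    intro x hx
    by_contra hn
    apply hx
    rcases lt_or_ge x a with hxa | hxa
    · refine (intervalIntegral.integral_congr (g := fun _ ↦ 0) fun t ht ↦ hz t fun h ↦ ?_).trans
        (by simp)
      have := ht.2
      have h3 : max 0 x < a := max_lt ha0.1 hxa
      linarith [h.1]
    · have hxb : b < x := by
        by_contra hh
        exact hn ⟨hxa, not_lt.1 hh⟩
      have h1 : ∫ t in (0 : ℝ)..x, η t =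
          (∫ t in (0 : ℝ)..L, η t) + ∫ t in L..x, η t :=
        (intervalIntegral.integral_add_adjacent_intervals (hi _ _) (hi _ _)).symm
      simp only [h1, h0, zero_add]
      refine (intervalIntegral.integral_congr (g := fun _ ↦ 0) fun t ht ↦ hz t fun h ↦ ?_).trans
        (by simp)
      have := ht.1
      have h3 : b < min L x := lt_min hb0.2 hxb
      linarith [h.2]
  have hts : tsupport (fun x ↦ ∫ t in (0 : ℝ)..x, η t) ⊆ Icc a b :=
    closure_minimal hsupp isClosed_Icc
  refine ⟨fun x ↦ ∫ t in (0 : ℝ)..x, η t, ?_, ?_, ?_, hder⟩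
  · rw [contDiff_infty_iff_deriv]
    exact ⟨fun x ↦ (hd x).differentiableAt, by rw [hder]; exact hη⟩
  · exact HasCompactSupport.of_support_subset_isCompact isCompact_Icc hsupp
  · exact hts.trans (Icc_subset_Ioo ha0.1 hb0.2)

lemma exists_testFunction_integral_one {L : ℝ} (hL : 0 < L) :
    ∃ θ : ℝ → ℝ, ContDiff ℝ ∞ θ ∧ HasCompactSupport θ ∧ tsupport θ ⊆ Ioo 0 L ∧
      ∫ x in (0 : ℝ)..L, θ x = 1 := by
  let B : ContDiffBump (L / 2) := ⟨L / 8, L / 4, by linarith, by linarith⟩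
  have hts : tsupport (B.normed volume) ⊆ Ioo 0 L := by
    rw [B.tsupport_normed_eq, Real.closedBall_eq_Icc]
    exact Icc_subset_Ioo (by simp only [B]; linarith) (by simp only [B]; linarith)
  refine ⟨B.normed volume, B.contDiff_normed, B.hasCompactSupport_normed, hts, ?_⟩
  rw [intervalIntegral.integral_of_le hL.le, setIntegral_eq_integral_of_forall_compl_eq_zero,
    B.integral_normed]
  exact fun x hx ↦ image_eq_zero_of_notMem_tsupport fun hm ↦ hx (Ioo_subset_Ioc_self (hts hm))

/-- The lemma of du Bois-Reymond on `[0, L]` for continuous functions. -/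
lemma eqOn_const_of_integral_mul_deriv_eq_zero {L : ℝ} (hL : 0 < L) {h : ℝ → ℝ}
    (hc : ContinuousOn h (Icc 0 L))
    (h0 : ∀ φ : ℝ → ℝ, ContDiff ℝ ∞ φ → HasCompactSupport φ → tsupport φ ⊆ Ioo 0 L →
      ∫ x in (0 : ℝ)..L, h x * deriv φ x = 0) :
    ∃ c, ∀ x ∈ Icc 0 L, h x = c := by
  obtain ⟨θ, hθ, hθc, hθs, hθ1⟩ := exists_testFunction_integral_one hL
  set c := ∫ x in (0 : ℝ)..L, h x * θ x with hcdef
  have hcu : ContinuousOn h (uIcc 0 L) := by rwa [uIcc_of_le hL.le]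
  have hint : ∀ η : ℝ → ℝ, ContDiff ℝ ∞ η →
      IntervalIntegrable (fun x ↦ h x * η x) volume 0 L := fun η hη ↦
    (hcu.mul hη.continuous.continuousOn).intervalIntegrable
  have hae : ∀ᵐ x, x ∈ Ioo 0 L → h x - c = 0 := by
    apply isOpen_Ioo.ae_eq_zero_of_integral_contDiff_smul_eq_zero
    · exact ((hc.mono Ioo_subset_Icc_self).sub continuousOn_const).locallyIntegrableOn
        measurableSet_Ioo
    intro η hη hηc hηs
    -- `η - m θ` has mean zero, hence is the derivative of a test function; testing with it turns
    -- `h0` into `∫ η (h - c) = 0`.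
    set m := ∫ x in (0 : ℝ)..L, η x with hm
    have hmθ : ContDiff ℝ ∞ (fun x ↦ m * θ x) := contDiff_const.mul hθ
    have hsub : tsupport (fun x ↦ η x - m * θ x) ⊆ tsupport η ∪ tsupport θ := by
      refine closure_minimal (fun x hx ↦ ?_) ((isClosed_tsupport _).union (isClosed_tsupport _))
      by_contra hn
      simp only [mem_union, not_or] at hn
      apply hx
      simp [image_eq_zero_of_notMem_tsupport hn.1, image_eq_zero_of_notMem_tsupport hn.2]
    obtain ⟨ψ, hψ, hψc, hψs, hψd⟩ := exists_testFunction_primitive (L := L)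
      (η := fun x ↦ η x - m * θ x) (hη.sub hmθ)
      (HasCompactSupport.of_support_subset_isCompact (hηc.union hθc)
        ((subset_tsupport _).trans hsub))
      (hsub.trans (union_subset hηs hθs))
      (by rw [intervalIntegral.integral_sub (hη.continuous.intervalIntegrable _ _)
            (hmθ.continuous.intervalIntegrable _ _), intervalIntegral.integral_const_mul, hθ1]
          simp [hm])
    have key := h0 ψ hψ hψc hψs
    rw [hψd] at key
    have e1 : ∫ x in (0 : ℝ)..L, h x * (η x - m * θ x) =
        (∫ x in (0 : ℝ)..L, h x * η x) - m * c := by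
      rw [hcdef, ← intervalIntegral.integral_const_mul,
        ← intervalIntegral.integral_sub (hint η hη) ((hint θ hθ).const_mul m)]
      exact intervalIntegral.integral_congr fun x _ ↦ by ring
    have e2 : ∫ x, η x • (h x - c) = ∫ x in (0 : ℝ)..L, η x * (h x - c) := by
      rw [intervalIntegral.integral_of_le hL.le,
        setIntegral_eq_integral_of_forall_compl_eq_zero]
      · rfl
      · intro x hx
        rw [image_eq_zero_of_notMem_tsupport fun hm ↦ hx (Ioo_subset_Ioc_self (hηs hm)), zero_mul]
    have e3 : ∫ x in (0 : ℝ)..L, η x * (h x - c) =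
        (∫ x in (0 : ℝ)..L, h x * η x) - c * m := by
      rw [hm, ← intervalIntegral.integral_const_mul,
        ← intervalIntegral.integral_sub (hint η hη)
          ((hη.continuous.intervalIntegrable _ _).const_mul c)]
      exact intervalIntegral.integral_congr fun x _ ↦ by ring
    rw [e2, e3]
    linarith
  have hae' : h =ᵐ[volume.restrict (Icc 0 L)] fun _ ↦ c := by
    rw [← restrict_Ioo_eq_restrict_Icc]
    rw [Filter.EventuallyEq, ae_restrict_iff' measurableSet_Ioo]
    filter_upwards [hae] with x hx hx'
    exact sub_eq_zero.1 (hx hx')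
  exact ⟨c, fun x hx ↦ Measure.eqOn_Icc_of_ae_eq volume hL.ne hae' hc continuousOn_const hx⟩

lemma MeasureTheory.MemLp.intervalIntegrable_of_Ioo {L : ℝ} (hL : 0 ≤ L) {g : ℝ → ℝ}
    (hg : MemLp g 2 (volume.restrict (Ioo 0 L))) : IntervalIntegrable g volume 0 L := by
  rw [intervalIntegrable_iff_integrableOn_Ioo_of_le hL]
  exact hg.integrable (by norm_num)

/-- The fundamental theorem of calculus in `H¹(0, L)`. -/
lemma IsH1.integral_eq_sub {L : ℝ} (hL : 0 < L) {u g : ℝ → ℝ} (h : IsH1 L u g) :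
    ∫ x in (0 : ℝ)..L, g x = u L - u 0 := by
  have hg := h.memLp_deriv.intervalIntegrable_of_Ioo hL.le
  have hGc : ContinuousOn (fun x ↦ ∫ t in (0 : ℝ)..x, g t) (Icc 0 L) :=
    continuousOn_primitive_Icc hL.le hg
  obtain ⟨c, hc⟩ := eqOn_const_of_integral_mul_deriv_eq_zero hL
    (h := fun x ↦ u x - ∫ t in (0 : ℝ)..x, g t) (h.continuousOn.sub hGc) (by
      intro φ hφ hφc hφs
      have hz : ∀ x, x ∉ Ioo 0 L → φ x = 0 := fun x hx ↦
        image_eq_zero_of_notMem_tsupport fun hm ↦ hx (hφs hm)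
      have h1 := integral_primitive_mul_deriv hg hφ 0
      simp only [zero_add, hz L (by simp), hz 0 (by simp), mul_zero, sub_zero, zero_sub] at h1
      have hd : Continuous (deriv φ) := hφ.continuous_deriv (by norm_num)
      have hi : ∀ v : ℝ → ℝ, ContinuousOn v (Icc 0 L) →
          IntervalIntegrable (fun x ↦ v x * deriv φ x) volume 0 L := fun v hv ↦ by
        apply ContinuousOn.intervalIntegrable
        rw [uIcc_of_le hL.le]
        exact hv.mul hd.continuousOn
      calc ∫ x in (0 : ℝ)..L, (u x - ∫ t in (0 : ℝ)..x, g t) * deriv φ x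
          = (∫ x in (0 : ℝ)..L, u x * deriv φ x)
            - ∫ x in (0 : ℝ)..L, (∫ t in (0 : ℝ)..x, g t) * deriv φ x := by
            rw [← intervalIntegral.integral_sub (hi _ h.continuousOn) (hi _ hGc)]
            exact intervalIntegral.integral_congr fun x _ ↦ by ring
        _ = 0 := by rw [h.weakDeriv φ hφ hφc hφs, h1, sub_self])
  have hl := hc L (right_mem_Icc.2 hL.le)
  have hr := hc 0 (left_mem_Icc.2 hL.le)
  simp only [intervalIntegral.integral_same] at hr
  linarith

/-- A primitive of a square integrable function is in `H¹(0, L)`. -/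
lemma isH1_of_eqOn_primitive {L : ℝ} (hL : 0 < L) {u g : ℝ → ℝ} (s : ℝ)
    (hg : MemLp g 2 (volume.restrict (Ioo 0 L)))
    (hu : ∀ x ∈ Icc 0 L, u x = s + ∫ t in (0 : ℝ)..x, g t) : IsH1 L u g := by
  have hgi := hg.intervalIntegrable_of_Ioo hL.le
  have hc : ContinuousOn u (Icc 0 L) :=
    (continuousOn_const.add (continuousOn_primitive_Icc hL.le hgi)).congr hu
  refine ⟨hc, ?_, hg, ?_⟩
  · obtain ⟨C, hC⟩ := isCompact_Icc.exists_bound_of_continuousOn hc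
    refine MemLp.of_bound ((hc.mono Ioo_subset_Icc_self).aestronglyMeasurable measurableSet_Ioo)
      C ?_
    exact (ae_restrict_iff' measurableSet_Ioo).2
      (Filter.Eventually.of_forall fun x hx ↦ hC x (Ioo_subset_Icc_self hx))
  · intro φ hφ _ hφs
    have hz : ∀ x, x ∉ Ioo 0 L → φ x = 0 := fun x hx ↦
      image_eq_zero_of_notMem_tsupport fun hm ↦ hx (hφs hm)
    have h1 := integral_primitive_mul_deriv hgi hφ s
    simp only [hz L (by simp), hz 0 (by simp), mul_zero, sub_zero, zero_sub] at h1
    rw [← h1]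
    refine intervalIntegral.integral_congr fun x hx ↦ ?_
    rw [uIcc_of_le hL.le] at hx
    simp only [hu x hx]

/-! ### The truncated nonlinearity -/

/-- The logistic nonlinearity `y (1 - y)`, extended by zero outside `[0, 1]`. -/
noncomputable def truncLogistic (y : ℝ) : ℝ := max 0 (min 1 y) * (1 - max 0 (min 1 y))

lemma clamp_mem (y : ℝ) : max 0 (min 1 y) ∈ Icc (0 : ℝ) 1 :=
  ⟨le_max_left _ _, max_le zero_le_one (min_le_left _ _)⟩

lemma truncLogistic_eq {y : ℝ} (h0 : 0 ≤ y) (h1 : y ≤ 1) : truncLogistic y = y * (1 - y) := by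
  rw [truncLogistic, min_eq_right h1, max_eq_right h0]

lemma truncLogistic_nonneg (y : ℝ) : 0 ≤ truncLogistic y :=
  mul_nonneg (clamp_mem y).1 (sub_nonneg.2 (clamp_mem y).2)

lemma truncLogistic_le_one (y : ℝ) : truncLogistic y ≤ 1 := by
  have := clamp_mem y
  unfold truncLogistic
  nlinarith [this.1, this.2]

/-- Linear control at the zero `y = 0`, in the form needed for comparison; the next lemma does the
same at `y = 1`. -/
lemma truncLogistic_le (y : ℝ) : truncLogistic y ≤ max y 0 := by
  have h := clamp_mem y
  have h2 : max 0 (min 1 y) ≤ max y 0 :=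
    max_le (le_max_right _ _) ((min_le_right _ _).trans (le_max_left _ _))
  unfold truncLogistic
  nlinarith [h.1, h.2]

lemma truncLogistic_le_one_sub (y : ℝ) : truncLogistic y ≤ max (1 - y) 0 := by
  have h := clamp_mem y
  have h2 : 1 - max 0 (min 1 y) ≤ max (1 - y) 0 := by
    rcases le_total 1 y with h1 | h1
    · rw [min_eq_left h1, max_eq_right zero_le_one, sub_self]
      exact le_max_right _ _
    · rw [min_eq_right h1]
      exact (sub_le_sub_left (le_max_right _ _) _).trans (le_max_left _ _)
  unfold truncLogistic
  nlinarith [h.1, h.2]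

lemma abs_clamp_sub_le (y z : ℝ) :
    |max 0 (min 1 y) - max 0 (min 1 z)| ≤ |y - z| := by
  refine (abs_max_sub_max_le_max _ _ _ _).trans ?_
  rw [sub_self, abs_zero]
  refine max_le (abs_nonneg _) ((abs_min_sub_min_le_max _ _ _ _).trans ?_)
  rw [sub_self, abs_zero]
  exact max_le (abs_nonneg _) le_rfl

lemma abs_truncLogistic_sub_le (y z : ℝ) :
    |truncLogistic y - truncLogistic z| ≤ |y - z| := by
  have hy := clamp_mem y
  have hz := clamp_mem z
  refine le_trans ?_ (abs_clamp_sub_le y z)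
  unfold truncLogistic
  generalize max 0 (min 1 y) = p at *
  generalize max 0 (min 1 z) = q at *
  have : p * (1 - p) - q * (1 - q) = (p - q) * (1 - p - q) := by ring
  rw [this, abs_mul]
  refine mul_le_of_le_one_right (abs_nonneg _) (abs_le.2 ⟨?_, ?_⟩) <;>
    linarith [hy.1, hy.2, hz.1, hz.2]

lemma continuous_truncLogistic : Continuous truncLogistic := by
  unfold truncLogistic
  fun_prop

/-! ### Comparison and the initial value problem -/

/-- One-sided comparison with zero. -/
lemma nonpos_of_deriv_le_mul_posPart {a b M : ℝ} (hab : a ≤ b) {v v' : ℝ → ℝ}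
    (hv : ∀ x ∈ Icc a b, HasDerivWithinAt v (v' x) (Icc a b) x)
    (hle : ∀ x ∈ Icc a b, v' x ≤ M * max (v x) 0) (ha : v a ≤ 0) : v b ≤ 0 := by
  -- The barrier grows at rate `M + 1` rather than `M`, so the derivative inequality is strict at
  -- contact; `δ` is arbitrarily small.
  have hδ : ∀ δ > 0, v b ≤ δ * Real.exp ((M + 1) * (b - a)) := by
    intro δ hδ
    have hB : ∀ x, HasDerivAt (fun x ↦ δ * Real.exp ((M + 1) * (x - a)))
        (δ * (Real.exp ((M + 1) * (x - a)) * (M + 1))) x := fun x ↦ by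
      have h1 : HasDerivAt (fun x ↦ (M + 1) * (x - a)) (M + 1) x := by
        simpa using ((hasDerivAt_id x).sub_const a).const_mul (M + 1)
      exact (h1.exp).const_mul δ
    refine image_le_of_deriv_right_lt_deriv_boundary (f := v) (f' := v')
      (fun x hx ↦ (hv x hx).continuousWithinAt)
      (fun x hx ↦ (hv x (Ico_subset_Icc_self hx)).mono_of_mem_nhdsWithin
        (Icc_mem_nhdsGE_of_mem hx)) ?_ hB ?_ (right_mem_Icc.2 hab)
    · simpa using ha.trans hδ.le
    · intro x hx hvx
      have h1 := hle x (Ico_subset_Icc_self hx)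
      have hpos : 0 < δ * Real.exp ((M + 1) * (x - a)) := by positivity
      rw [hvx, max_eq_left hpos.le] at h1
      linarith
  by_contra! hn
  have hE := Real.exp_pos ((M + 1) * (b - a))
  have := hδ (v b / (2 * Real.exp ((M + 1) * (b - a)))) (by positivity)
  have e : v b / (2 * Real.exp ((M + 1) * (b - a))) * Real.exp ((M + 1) * (b - a)) = v b / 2 := by
    field_simp
  linarith

/-- Solutions of `u' = f (u - c (1 - s) K) / ε`, `u 0 = s`, on `[0, L]`, with `f` the truncated
logistic nonlinearity, depending continuously on the parameter `s`. -/
lemma exists_parametrized_solution {ε L c : ℝ} (hε : 0 < ε) (hL : 0 < L) {K : ℝ → ℝ}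
    (hK : ContinuousOn K (Icc 0 L)) :
    ∃ U : ℝ → ℝ → ℝ, (∀ s ∈ Icc (0 : ℝ) 1, U s 0 = s ∧ ∀ t ∈ Icc 0 L,
      HasDerivWithinAt (U s) (truncLogistic (U s t - c * (1 - s) * K t) / ε) (Icc 0 L) t) ∧
      ContinuousOn (fun s ↦ U s L) (Icc 0 1) := by
  obtain ⟨D, hD⟩ := isCompact_Icc.exists_bound_of_continuousOn hK
  have hD0 : 0 ≤ D := (norm_nonneg _).trans (hD 0 (left_mem_Icc.2 hL.le))
  -- The parameter `s` becomes a second, constant component, so continuity in `s` follows from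
  -- Lipschitz dependence on initial data.
  let F : ℝ → ℝ × ℝ → ℝ × ℝ := fun t p ↦ (truncLogistic (p.1 - c * (1 - p.2) * K t) / ε, 0)
  -- Radius: initial data of norm at most `1`, then speed at most `1 / ε` for time `L`.
  have hPL : IsPicardLindelof F (⟨0, left_mem_Icc.2 hL.le⟩ : Icc 0 L) (0 : ℝ × ℝ)
      (L / ε + 1).toNNReal 1 (1 / ε).toNNReal ((1 + |c| * D) / ε).toNNReal := by
    refine ⟨fun t ht ↦ ?_, fun p _ ↦ ?_, fun t ht p _ ↦ ?_, ?_⟩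
    · refine LipschitzOnWith.of_dist_le_mul fun p _ q _ ↦ ?_
      rw [Real.coe_toNNReal _ (by positivity), dist_eq_norm, dist_eq_norm]
      have h1 : ‖F t p - F t q‖ = |truncLogistic (p.1 - c * (1 - p.2) * K t)
          - truncLogistic (q.1 - c * (1 - q.2) * K t)| / ε := by
        simp only [F, Prod.mk_sub_mk, sub_self, Prod.norm_mk, norm_zero, ← sub_div, norm_div,
          Real.norm_eq_abs, abs_of_pos hε]
        exact max_eq_left (by positivity)
      have h2 : |(p - q).1| ≤ ‖p - q‖ := norm_fst_le (p - q)
      have h3 : |(p - q).2| ≤ ‖p - q‖ := norm_snd_le (p - q)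
      rw [h1, div_mul_eq_mul_div]
      gcongr
      refine (abs_truncLogistic_sub_le _ _).trans ?_
      have h4 : p.1 - c * (1 - p.2) * K t - (q.1 - c * (1 - q.2) * K t) =
          (p - q).1 + c * K t * (p - q).2 := by
        simp only [Prod.fst_sub, Prod.snd_sub]; ring
      have h5 : |K t| ≤ D := hD t ht
      rw [h4]
      calc |(p - q).1 + c * K t * (p - q).2|
          ≤ |(p - q).1| + |c| * |K t| * |(p - q).2| := by
            rw [← abs_mul, ← abs_mul]; exact abs_add_le _ _
        _ ≤ ‖p - q‖ + |c| * D * ‖p - q‖ := by gcongr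
        _ = (1 + |c| * D) * ‖p - q‖ := by ring
    · exact ((continuous_truncLogistic.comp_continuousOn
        (continuousOn_const.sub (continuousOn_const.mul hK))).div_const ε).prodMk
        continuousOn_const
    · rw [Real.coe_toNNReal _ (by positivity)]
      simp only [F, Prod.norm_mk, norm_zero, norm_div, Real.norm_eq_abs, abs_of_pos hε,
        abs_of_nonneg (truncLogistic_nonneg _)]
      refine max_le ?_ (by positivity)
      gcongr
      exact truncLogistic_le_one _
    · rw [Real.coe_toNNReal _ (by positivity), Real.coe_toNNReal _ (by positivity)]
      simp only [sub_zero, sub_self, max_eq_left hL.le, NNReal.coe_one, add_sub_cancel_right]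
      exact le_of_eq (by ring)
  obtain ⟨A, hA, L', hL'⟩ :=
    hPL.exists_forall_mem_closedBall_eq_hasDerivWithinAt_lipschitzOnWith
  have hball : ∀ s ∈ Icc (0 : ℝ) 1, ((s, s) : ℝ × ℝ) ∈ Metric.closedBall (0 : ℝ × ℝ) (1 : NNReal) :=
    fun s hs ↦ by
      rw [mem_closedBall_zero_iff, Prod.norm_mk, max_self, Real.norm_eq_abs, abs_of_nonneg hs.1]
      exact hs.2
  refine ⟨fun s t ↦ (A (s, s) t).1, fun s hs ↦ ?_, ?_⟩
  · obtain ⟨h0, hd⟩ := hA _ (hball s hs)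
    have hfst : ∀ t ∈ Icc 0 L, HasDerivWithinAt (fun t ↦ (A (s, s) t).1)
        (F t (A (s, s) t)).1 (Icc 0 L) t := fun t ht ↦ (hd t ht).fst
    have hsnd : ∀ t ∈ Icc 0 L, HasDerivWithinAt (fun t ↦ (A (s, s) t).2) 0 (Icc 0 L) t :=
      fun t ht ↦ (hd t ht).snd
    have hconst : ∀ t ∈ Icc 0 L, (A (s, s) t).2 = s := fun t ht ↦ by
      have := constant_of_has_deriv_right_zero (fun t ht ↦ (hsnd t ht).continuousWithinAt)
        (fun x hx ↦ (hsnd x (Ico_subset_Icc_self hx)).mono_of_mem_nhdsWithin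
          (Icc_mem_nhdsGE_of_mem hx)) t ht
      rw [this]
      exact congrArg Prod.snd h0
    refine ⟨congrArg Prod.fst h0, fun t ht ↦ ?_⟩
    have := hfst t ht
    simp only [F, hconst t ht] at this
    exact this
  · have h1 := (hL' L (right_mem_Icc.2 hL.le)).continuousOn
    exact continuous_fst.comp_continuousOn
      (h1.comp (continuous_id.prodMk continuous_id).continuousOn hball)

/-! ### The coefficient `k` and its reciprocal -/

/-- An almost everywhere lower bound holds at every point of relative continuity. -/
lemma ContinuousWithinAt.le_of_ae_le {L c : ℝ} (hL : 0 < L) {k : ℝ → ℝ} {x : ℝ}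
    (hx : x ∈ Icc 0 L) (hk : ContinuousWithinAt k (Icc 0 L) x)
    (hc : ∀ᵐ x ∂(volume.restrict (Icc 0 L)), c ≤ k x) : c ≤ k x := by
  rw [ae_restrict_iff' measurableSet_Icc] at hc
  have hd : Dense {x | x ∈ Icc 0 L → c ≤ k x} := Measure.dense_of_ae hc
  have h1 : Icc 0 L ⊆ closure (Ioo 0 L ∩ {x | x ∈ Icc 0 L → c ≤ k x}) := by
    refine (closure_Ioo hL.ne).symm.subset.trans ?_
    exact closure_minimal (hd.open_subset_closure_inter isOpen_Ioo) isClosed_closure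
  have hcl := h1 hx
  rw [mem_closure_iff_nhdsWithin_neBot] at hcl
  have hk' := hk.mono (t := Icc 0 L)
    (inter_subset_left.trans Ioo_subset_Icc_self :
      Ioo 0 L ∩ {x | x ∈ Icc 0 L → c ≤ k x} ⊆ Icc 0 L)
  refine ge_of_tendsto hk' ?_
  filter_upwards [self_mem_nhdsWithin] with y hy
  exact hy.2 (Ioo_subset_Icc_self hy.1)

lemma memLp_inv_of_le {L c : ℝ} (hc : 0 < c) {k : ℝ → ℝ}
    (hk : AEStronglyMeasurable k (volume.restrict (Icc 0 L)))
    (hck : ∀ᵐ x ∂(volume.restrict (Icc 0 L)), c ≤ k x) :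
    MemLp (fun x ↦ (k x)⁻¹) 2 (volume.restrict (Icc 0 L)) := by
  refine MemLp.of_bound hk.aemeasurable.inv.aestronglyMeasurable c⁻¹ ?_
  filter_upwards [hck] with x hx
  rw [Real.norm_eq_abs, abs_of_nonneg (inv_nonneg.2 (hc.le.trans hx))]
  exact inv_anti₀ hc hx

lemma monotoneOn_primitive_of_ae_nonneg {L : ℝ} {g : ℝ → ℝ}
    (hg : IntervalIntegrable g volume 0 L)
    (h0 : ∀ᵐ x ∂(volume.restrict (Icc 0 L)), 0 ≤ g x) :
    MonotoneOn (fun x ↦ ∫ t in (0 : ℝ)..x, g t) (Icc 0 L) := by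
  intro x hx y hy hxy
  have hi : ∀ z ∈ Icc 0 L, IntervalIntegrable g volume 0 z := fun z hz ↦
    hg.mono_set (uIcc_subset_uIcc left_mem_uIcc (Icc_subset_uIcc hz))
  have h1 : 0 ≤ ∫ t in x..y, g t := intervalIntegral.integral_nonneg_of_ae_restrict hxy
    (ae_restrict_of_ae_restrict_of_subset (Icc_subset_Icc hx.1 hy.2) h0)
  have h2 := intervalIntegral.integral_interval_sub_left (hi y hy) (hi x hx)
  simp only
  linarith

/-! ### Bounds on `ρ` and shooting -/

/-- If `ρ = u - K` with `K` nondecreasing and `u' = f ρ / ε`, with `f` the truncated logistic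
nonlinearity, then `ρ` stays nonpositive after reaching a nonpositive value. -/
lemma sub_nonpos_of_sub_nonpos_left {ε L x₀ : ℝ} (hε : 0 < ε) {u K : ℝ → ℝ}
    (hK : MonotoneOn K (Icc 0 L))
    (hu : ∀ t ∈ Icc 0 L, HasDerivWithinAt u (truncLogistic (u t - K t) / ε) (Icc 0 L) t)
    (hx₀ : x₀ ∈ Icc 0 L) (h : u x₀ - K x₀ ≤ 0) : u L - K L ≤ 0 := by
  have hLm : L ∈ Icc 0 L := ⟨hx₀.1.trans hx₀.2, le_rfl⟩
  have hsub : Icc x₀ L ⊆ Icc 0 L := Icc_subset_Icc_left hx₀.1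
  -- Freezing `K` at `x₀` leaves a differentiable function that dominates `u - K` to the right of
  -- `x₀`.
  have key := nonpos_of_deriv_le_mul_posPart (M := 1 / ε) (v := fun x ↦ u x - K x₀)
    (v' := fun t ↦ truncLogistic (u t - K t) / ε) hx₀.2
    (fun x hx ↦ ((hu x (hsub hx)).mono hsub).sub_const _) (fun x hx ↦ by
      have h1 := hK hx₀ (hsub hx) hx.1
      rw [one_div, ← div_eq_inv_mul]
      gcongr
      exact (truncLogistic_le _).trans (max_le_max_right _ (by linarith))) h
  have := hK hx₀ hLm hx₀.2
  linarith

/-- In the situation of `sub_nonpos_of_sub_nonpos_left`, the function `ρ` stays below `1` if it starts there. -/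
lemma sub_lt_one {ε L x₀ : ℝ} (hε : 0 < ε) {u K : ℝ → ℝ}
    (hK : MonotoneOn K (Icc 0 L))
    (hu : ∀ t ∈ Icc 0 L, HasDerivWithinAt u (truncLogistic (u t - K t) / ε) (Icc 0 L) t)
    (hx₀ : x₀ ∈ Icc 0 L) (h : u 0 - K 0 < 1) : u x₀ - K x₀ < 1 := by
  by_contra! hn
  have h0m : (0 : ℝ) ∈ Icc 0 L := ⟨le_rfl, hx₀.1.trans hx₀.2⟩
  have hmaps : MapsTo (fun x ↦ x₀ - x) (Icc 0 x₀) (Icc 0 L) := fun x hx ↦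
    ⟨by linarith [hx.2], by linarith [hx.1, hx₀.2]⟩
  -- Run backwards from `x₀`, again with `K` frozen: `ρ x₀ ≥ 1` would force `ρ 0 ≥ 1`.
  have key := nonpos_of_deriv_le_mul_posPart (M := 1 / ε)
    (v := fun x ↦ 1 + K x₀ - u (x₀ - x))
    (v' := fun x ↦ truncLogistic (u (x₀ - x) - K (x₀ - x)) / ε) hx₀.1
    (fun x hx ↦ by
      have h1 : HasDerivWithinAt (fun x ↦ x₀ - x) (-1) (Icc 0 x₀) x :=
        (hasDerivWithinAt_id x _).const_sub x₀
      have h2 := ((hu (x₀ - x) (hmaps hx)).comp x h1 hmaps).const_sub (1 + K x₀)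
      simpa using h2)
    (fun x hx ↦ by
      have h1 := hK (hmaps hx) hx₀ (by linarith [hx.1])
      rw [one_div, ← div_eq_inv_mul]
      gcongr
      exact (truncLogistic_le_one_sub _).trans (max_le_max_right _ (by linarith)))
    (by simpa using by linarith)
  have := hK h0m hx₀ hx₀.1
  simp only [sub_self] at key
  linarith

/-- Shooting: the flux `J = a (1 - ρ 0)` can be chosen such that `b ρ L = J`. -/
lemma exists_shooting_solution {ε L a b : ℝ} (hε : 0 < ε) (hL : 0 < L) (ha : 0 < a) (hb : 0 < b)
    {K : ℝ → ℝ} (hKc : ContinuousOn K (Icc 0 L)) (hK : MonotoneOn K (Icc 0 L)) (hK0 : K 0 = 0) :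
    ∃ s : ℝ, ∃ u : ℝ → ℝ, u 0 = s ∧
      (∀ t ∈ Icc 0 L, HasDerivWithinAt u
        (truncLogistic (u t - a / ε * (1 - s) * K t) / ε) (Icc 0 L) t) ∧
      b * (u L - a / ε * (1 - s) * K L) = a * (1 - s) ∧
      ∀ t ∈ Icc 0 L, 0 < u t - a / ε * (1 - s) * K t ∧ u t - a / ε * (1 - s) * K t < 1 := by
  obtain ⟨U, hU, hUc⟩ := exists_parametrized_solution (c := a / ε) hε hL hKc
  have h0L : (0 : ℝ) ∈ Icc 0 L := left_mem_Icc.2 hL.le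
  have hmono : ∀ s ∈ Icc (0 : ℝ) 1, MonotoneOn (fun t ↦ a / ε * (1 - s) * K t) (Icc 0 L) :=
    fun s hs x hx y hy hxy ↦ mul_le_mul_of_nonneg_left (hK hx hy hxy)
      (mul_nonneg (by positivity) (sub_nonneg.2 hs.2))
  have hG : ContinuousOn (fun s ↦ b * (U s L - a / ε * (1 - s) * K L) - a * (1 - s))
      (Icc 0 1) := by fun_prop
  have hm0 : (0 : ℝ) ∈ Icc (0 : ℝ) 1 := by simp
  have hm1 : (1 : ℝ) ∈ Icc (0 : ℝ) 1 := by simp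
  have hG0 : b * (U 0 L - a / ε * (1 - 0) * K L) - a * (1 - 0) < 0 := by
    have := sub_nonpos_of_sub_nonpos_left hε (hmono 0 hm0) (hU 0 hm0).2 h0L (by simp [hK0, (hU 0 hm0).1])
    nlinarith
  -- At `s = 1` the flux is zero, so `ρ = u` is nondecreasing from `1`.
  have hG1 : 0 < b * (U 1 L - a / ε * (1 - 1) * K L) - a * (1 - 1) := by
    have h1 := nonpos_of_deriv_le_mul_posPart (M := 0) (v := fun t ↦ 1 - U 1 t) hL.le
      (fun t ht ↦ ((hU 1 hm1).2 t ht).const_sub 1)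
      (fun t _ ↦ by
        have := div_nonneg (truncLogistic_nonneg (U 1 t - a / ε * (1 - 1) * K t)) hε.le
        linarith)
      (by simp [(hU 1 hm1).1])
    have h2 : 1 ≤ U 1 L := by simpa using h1
    simp only [sub_self, mul_zero, zero_mul, sub_zero]
    positivity
  obtain ⟨s, hs, hGs⟩ := intermediate_value_Ioo zero_le_one hG ⟨hG0, hG1⟩
  have hsI := Ioo_subset_Icc_self hs
  obtain ⟨hu0, hu⟩ := hU s hsI
  have hbal : b * (U s L - a / ε * (1 - s) * K L) = a * (1 - s) := sub_eq_zero.1 hGs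
  refine ⟨s, U s, hu0, hu, hbal, fun t ht ↦ ⟨?_, ?_⟩⟩
  · by_contra! hn
    have h1 := sub_nonpos_of_sub_nonpos_left hε (hmono s hsI) hu ht hn
    have h2 : 0 < a * (1 - s) := mul_pos ha (sub_pos.2 hs.2)
    have h3 := mul_nonpos_of_nonneg_of_nonpos hb.le h1
    linarith
  · exact sub_lt_one hε (hmono s hsI) hu ht (by simpa [hK0, hu0] using hs.2)

/-! ### Assembling the weak solution -/

theorem theorem3p1 (ε L α β : ℝ) (hε : 0 < ε) (hL : 0 < L)
    (hα0 : 0 < α) (hα1 : α < 1) (hβ0 : 0 < β) (hβ1 : β < 1)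
    (k : ℝ → ℝ)
    (hk : MemLp k ⊤ (volume.restrict (Icc 0 L)))
    (hkpos : ∃ c : ℝ, 0 < c ∧ ∀ᵐ x ∂(volume.restrict (Icc 0 L)), c ≤ k x)
    (hk0 : ContinuousWithinAt k (Icc 0 L) 0)
    (hkL : ContinuousWithinAt k (Icc 0 L) L) :
    ∃ ρ : ℝ → ℝ, IsWeakSolution ε L α β k ρ ∧ ∀ x ∈ Icc 0 L, 0 < ρ x ∧ ρ x < 1 := by
  obtain ⟨c, hc, hck⟩ := hkpos
  have hm0 : (0 : ℝ) ∈ Icc 0 L := left_mem_Icc.2 hL.le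
  have hmL : L ∈ Icc 0 L := right_mem_Icc.2 hL.le
  have hk0' : 0 < k 0 := hc.trans_le (hk0.le_of_ae_le hL hm0 hck)
  have hkL' : 0 < k L := hc.trans_le (hkL.le_of_ae_le hL hmL hck)
  have hκ2 : MemLp (fun x ↦ (k x)⁻¹) 2 (volume.restrict (Ioo 0 L)) :=
    (memLp_inv_of_le hc hk.1 hck).mono_measure (Measure.restrict_mono Ioo_subset_Icc_self le_rfl)
  have hκi := hκ2.intervalIntegrable_of_Ioo hL.le
  have hκ0 : ∀ᵐ x ∂(volume.restrict (Icc 0 L)), 0 ≤ (k x)⁻¹ := by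
    filter_upwards [hck] with x hx using inv_nonneg.2 (hc.le.trans hx)
  set K : ℝ → ℝ := fun x ↦ ∫ t in (0 : ℝ)..x, (k t)⁻¹ with hKdef
  have hKc : ContinuousOn K (Icc 0 L) := continuousOn_primitive_Icc hL.le hκi
  obtain ⟨s, u, hu0, hu, hbal, hρ⟩ := exists_shooting_solution (a := α * k 0) (b := β * k L) hε hL
    (by positivity) (by positivity) hKc (monotoneOn_primitive_of_ae_nonneg hκi hκ0)
    (by simp [hKdef])
  set J := α * k 0 * (1 - s) with hJ
  set ρ : ℝ → ℝ := fun t ↦ u t - α * k 0 / ε * (1 - s) * K t with hρdef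
  have hρ0 : ρ 0 = s := by simp [hρdef, hKdef, hu0]
  have huc : ContinuousOn u (Icc 0 L) := fun t ht ↦ (hu t ht).continuousWithinAt
  have hfc : ContinuousOn (fun t ↦ truncLogistic (ρ t) / ε) (Icc 0 L) :=
    (continuous_truncLogistic.comp_continuousOn
      (huc.sub (continuousOn_const.mul hKc))).div_const ε
  have hf2 : MemLp (fun t ↦ truncLogistic (ρ t) / ε) 2 (volume.restrict (Ioo 0 L)) := by
    refine MemLp.of_bound ((hfc.mono Ioo_subset_Icc_self).aestronglyMeasurable measurableSet_Ioo)
      (1 / ε) (Filter.Eventually.of_forall fun x ↦ ?_)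
    rw [Real.norm_eq_abs, abs_of_nonneg (div_nonneg (truncLogistic_nonneg _) hε.le)]
    gcongr
    exact truncLogistic_le_one _
  have hg2 : MemLp (fun t ↦ truncLogistic (ρ t) / ε - J / ε * (k t)⁻¹) 2
      (volume.restrict (Ioo 0 L)) := hf2.sub (hκ2.const_mul (J / ε))
  have hprim : ∀ x ∈ Icc 0 L,
      ρ x = s + ∫ t in (0 : ℝ)..x, (truncLogistic (ρ t) / ε - J / ε * (k t)⁻¹) := by
    intro x hx
    have hsub : Icc 0 x ⊆ Icc 0 L := Icc_subset_Icc_right hx.2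
    have hfi : IntervalIntegrable (fun t ↦ truncLogistic (ρ t) / ε) volume 0 x := by
      apply ContinuousOn.intervalIntegrable
      rw [uIcc_of_le hx.1]
      exact hfc.mono hsub
    have hftc : ∫ t in (0 : ℝ)..x, truncLogistic (ρ t) / ε = u x - u 0 :=
      intervalIntegral.integral_eq_sub_of_hasDerivAt_of_le hx.1 (huc.mono hsub)
        (fun t ht ↦ (hu t (hsub (Ioo_subset_Icc_self ht))).hasDerivAt
          (Icc_mem_nhds ht.1 (ht.2.trans_le hx.2))) hfi
    have hκx : IntervalIntegrable (fun t ↦ (k t)⁻¹) volume 0 x :=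
      hκi.mono_set (uIcc_subset_uIcc left_mem_uIcc (Icc_subset_uIcc hx))
    rw [intervalIntegral.integral_sub hfi (hκx.const_mul _), hftc,
      intervalIntegral.integral_const_mul, hu0]
    simp only [hρdef, hKdef, hJ]
    ring
  refine ⟨ρ, ⟨_, isH1_of_eqOn_primitive hL s hg2 hprim, fun φ dφ hφ ↦ ?_⟩, hρ⟩
  -- As `0 < ρ < 1`, the logistic terms cancel and `k` meets its inverse, leaving the constant `-J`.
  have hint : ∫ x in (0 : ℝ)..L, k x * (ε * (truncLogistic (ρ x) / ε - J / ε * (k x)⁻¹)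
      - ρ x * (1 - ρ x)) * dφ x = ∫ x in (0 : ℝ)..L, -J * dφ x := by
    apply intervalIntegral.integral_congr_ae
    rw [ae_restrict_iff' measurableSet_Icc] at hck
    filter_upwards [hck] with x hx hx'
    have hxI : x ∈ Icc 0 L := by
      rw [uIoc_of_le hL.le] at hx'
      exact Ioc_subset_Icc_self hx'
    have hkx : k x ≠ 0 := (hc.trans_le (hx hxI)).ne'
    rw [truncLogistic_eq (y := ρ x) (hρ x hxI).1.le (hρ x hxI).2.le]
    field_simp
    ring
  rw [hint, intervalIntegral.integral_const_mul, hφ.integral_eq_sub hL, hρ0, ← hJ]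
  have hbal' : β * k L * ρ L = J := hbal
  rw [hbal']
  ring
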